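/- Let $\Gamma=(\mathcal V,\mathcal E)$ be a finite simple graph with $e$ edges, and let $d\ge 0$ be an integer. After fixing an identification (bijection) of the edges of $\Gamma$ with the coordinate axes of $\mathbb R^e$, the $d$-dimensional measurement set $M_d(\Gamma)\subseteq\mathbb R^e$ is the set of all vectors of squared edge lengths $\bigl(\lVert p(u)-p(w)\rVert^2\bigr)_{\{u,w\}\in\mathcal E}$, where $p$ ranges over all maps from $\mathcal V$ to the Euclidean space $\mathbb E^d$. Two finite simple graphs $\Gamma$ and $\Delta$, both with $e$ edges, are called $d$-measurement isomorphic if there are identifications of the edges of $\Gamma$ and of the edges of $\Delta$ with the coordinate axes of $\mathbb R^e$ under which $M_d(\Gamma)=M_d(\Delta)$. Corollary. Let $d_1\ge 1$ and $d_2\ge 0$ be integers, and let $\Gamma$ and $\Delta$ be finite simple graphs. If $\Gamma$ and $\Delta$ are $d_1$-measurement isomorphic, then they are $d_2$-measurement isomorphic. In particular, for $d\ge 1$, the property of being $d$-measurement isomorphic does not depend on $d$. -/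

import Mathlib

namespace SimpleGraph

/-- A configuration of the vertex set `V` in `d`-dimensional Euclidean space. -/
abbrev Configuration (V : Type*) (d : ℕ) : Type _ := V → EuclideanSpace ℝ (Fin d)

/-- The squared length of the pair `s(u, w)` under the configuration `p`,
namely `‖p u - p w‖ ^ 2`. -/
noncomputable def sqLength {V : Type*} {d : ℕ} (p : Configuration V d) : Sym2 V → ℝ :=
  Sym2.lift ⟨fun u w => ‖p u - p w‖ ^ 2,
    fun u w => congrArg (· ^ 2) (norm_sub_rev (p u) (p w))⟩

/-- The length-squared function of a graph with `e` edges, where `ι` identifies the edges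
with the coordinate axes of `ℝ ^ e`. -/
noncomputable def lengthSquared {V : Type*} (Γ : SimpleGraph V) {d e : ℕ} (ι : Γ.edgeSet ≃ Fin e)
    (p : Configuration V d) : Fin e → ℝ :=
  fun i => sqLength p (ι.symm i : Sym2 V)

/-- The `d`-dimensional measurement set of a graph, as a subset of `ℝ ^ e`, relative to an
identification `ι` of its edges with the coordinate axes. -/
def measurementSet {V : Type*} (Γ : SimpleGraph V) (d : ℕ) {e : ℕ} (ι : Γ.edgeSet ≃ Fin e) :
    Set (Fin e → ℝ) :=
  Set.range (fun p : Configuration V d => lengthSquared Γ ι p)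

/-- Two graphs with the same number `e` of edges are `d`-measurement isomorphic if, for some
identifications of their edges with the coordinate axes of `ℝ ^ e`, their `d`-dimensional
measurement sets coincide. -/
def MeasurementIsomorphic {V W : Type*} (d : ℕ) (Γ : SimpleGraph V) (Δ : SimpleGraph W) : Prop :=
  ∃ (e : ℕ) (ι : Γ.edgeSet ≃ Fin e) (κ : Δ.edgeSet ≃ Fin e),
    measurementSet Γ d ι = measurementSet Δ d κ

end SimpleGraph

/-! Let U be the space of edge differences of vertex potentials. The measurement set consists of the
sums of d coordinatewise squares of vectors of U, so for d ≥ 1 it determines which inequalities x_e²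
≤ r ∑ w_i x_i² hold on U. For weights w ≥ 0 with reproducing kernel K, the optimal r is K e e, so
the diagonal of K is determined. Raising a weight is a rank-one update of K; comparing diagonals
after updates also recovers the squares of entries (`sq_eq`) and the triple products (`triple_eq`).
When the support of K is transitive, these fix K up to conjugation by signs, hence U up to sign
changes of coordinates. Such changes leave the measurement sets of every dimension unchanged. -/

/-- `K` is the reproducing kernel of the subspace `U` for the bilinear form with weights `w`:
its rows lie in `U` and represent the coordinate functionals on `U`. -/
structure IsReproducingKernel {E : Type*} [Fintype E] (U : Submodule ℝ (E → ℝ)) (w : E → ℝ)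
    (K : E → E → ℝ) : Prop where
  mem : ∀ e, K e ∈ U
  repr : ∀ e, ∀ x ∈ U, ∑ i, w i * K e i * x i = x e

/-- The coordinate functionals on `U` and on `U'` satisfy the same weighted quadratic bounds. -/
def SameCoordinateBounds {E : Type*} [Fintype E] (U U' : Submodule ℝ (E → ℝ)) : Prop :=
  ∀ (w : E → ℝ) (e : E) (r : ℝ),
    (∀ x ∈ U, x e ^ 2 ≤ r * ∑ i, w i * x i ^ 2) ↔ (∀ x ∈ U', x e ^ 2 ≤ r * ∑ i, w i * x i ^ 2)

theorem SameCoordinateBounds.symm {E : Type*} [Fintype E] {U U' : Submodule ℝ (E → ℝ)}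
    (h : SameCoordinateBounds U U') : SameCoordinateBounds U' U :=
  fun w e r => (h w e r).symm

/-- The effect on a reproducing kernel of increasing the weight of `g` by `t`. -/
noncomputable def kernelUpdate {E : Type*} (K : E → E → ℝ) (g : E) (t : ℝ) : E → E → ℝ :=
  fun e f => K e f - t * K e g / (1 + t * K g g) * K g f

theorem weight_nonneg_update {E : Type*} [DecidableEq E] {w : E → ℝ} (hw : ∀ i, 0 ≤ w i)
    (g : E) {t : ℝ} (ht : 0 ≤ t) (i : E) : 0 ≤ (w + Pi.single g t : E → ℝ) i :=
  add_nonneg (hw i) ((Pi.single_nonneg.2 ht : (0 : E → ℝ) ≤ Pi.single g t) i)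

namespace IsReproducingKernel

variable {E : Type*} [Fintype E] {U U' : Submodule ℝ (E → ℝ)} {w : E → ℝ} {K K' : E → E → ℝ}

/-- Row `e` is the orthogonal projection onto `U` of the basis vector at `e`; self-adjointness gives
the reproducing property. -/
theorem exists_one (U : Submodule ℝ (E → ℝ)) : ∃ K, IsReproducingKernel U (fun _ => 1) K := by
  classical
  let T : EuclideanSpace ℝ E ≃ₗ[ℝ] (E → ℝ) := WithLp.linearEquiv 2 ℝ (E → ℝ)
  let P : Submodule ℝ (EuclideanSpace ℝ E) := U.comap T.toLinearMap
  refine ⟨fun e => T (P.starProjection (EuclideanSpace.single e 1)), ⟨fun e => ?_, fun e x hx => ?_⟩⟩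
  · exact P.starProjection_apply_mem (EuclideanSpace.single e 1)
  · have hx' : T.symm x ∈ P := by simpa [P] using hx
    have h := Submodule.inner_starProjection_left_eq_right P (EuclideanSpace.single e 1) (T.symm x)
    rw [Submodule.starProjection_eq_self_iff.mpr hx', EuclideanSpace.inner_single_left] at h
    simp only [PiLp.inner_apply, RCLike.inner_apply, conj_trivial, one_mul] at h
    rw [← show T.symm x e = x e from rfl, ← h]
    refine Finset.sum_congr rfl fun i _ => ?_
    rw [one_mul, mul_comm]
    rfl

theorem symm (hK : IsReproducingKernel U w K) (e f : E) : K e f = K f e := by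
  rw [← hK.repr f (K e) (hK.mem e), ← hK.repr e (K f) (hK.mem f)]
  exact Finset.sum_congr rfl fun i _ => by ring

theorem sum_sq (hK : IsReproducingKernel U w K) (e : E) : ∑ i, w i * K e i ^ 2 = K e e := by
  rw [← hK.repr e (K e) (hK.mem e)]
  exact Finset.sum_congr rfl fun i _ => by ring

theorem diag_nonneg (hK : IsReproducingKernel U w K) (hw : ∀ i, 0 ≤ w i) (e : E) : 0 ≤ K e e := by
  rw [← hK.sum_sq e]
  exact Finset.sum_nonneg fun i _ => mul_nonneg (hw i) (sq_nonneg _)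

theorem sq_apply_le (hK : IsReproducingKernel U w K) (hw : ∀ i, 0 ≤ w i) (e : E) {x : E → ℝ}
    (hx : x ∈ U) : x e ^ 2 ≤ K e e * ∑ i, w i * x i ^ 2 := by
  rw [← hK.sum_sq e, ← hK.repr e x hx]
  refine Finset.sum_sq_le_sum_mul_sum_of_sq_le_mul _ (fun i _ => mul_nonneg (hw i) (sq_nonneg _))
    (fun i _ => mul_nonneg (hw i) (sq_nonneg _)) fun i _ => le_of_eq (by ring)

/-- By Cauchy–Schwarz the constant `K e e` is valid on `U`, hence on `U'`; test it on the row `K'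
e`. -/
theorem diag_le (hU : SameCoordinateBounds U U') (hw : ∀ i, 0 ≤ w i)
    (hK : IsReproducingKernel U w K) (hK' : IsReproducingKernel U' w K') (e : E) :
    K' e e ≤ K e e := by
  have h := (hU w e (K e e)).1 (fun x hx => hK.sq_apply_le hw e hx) (K' e) (hK'.mem e)
  rw [hK'.sum_sq e] at h
  have h0 := hK.diag_nonneg hw e
  by_contra! hlt
  nlinarith

theorem diag_eq (hU : SameCoordinateBounds U U') (hw : ∀ i, 0 ≤ w i)
    (hK : IsReproducingKernel U w K) (hK' : IsReproducingKernel U' w K') (e : E) :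
    K e e = K' e e :=
  le_antisymm (diag_le hU.symm hw hK' hK e) (diag_le hU hw hK hK' e)

/-- This is the Sherman–Morrison formula; `0 ≤ t` keeps the denominator positive. -/
theorem update [DecidableEq E] (hK : IsReproducingKernel U w K) (hw : ∀ i, 0 ≤ w i) (g : E) {t : ℝ}
    (ht : 0 ≤ t) : IsReproducingKernel U (w + Pi.single g t) (kernelUpdate K g t) := by
  have hpos : 0 < 1 + t * K g g := by have := mul_nonneg ht (hK.diag_nonneg hw g); linarith
  refine ⟨fun e => U.sub_mem (hK.mem e) (U.smul_mem _ (hK.mem g)), fun e x hx => ?_⟩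
  have hsplit : ∀ i, (w + Pi.single g t : E → ℝ) i * kernelUpdate K g t e i * x i
      = w i * K e i * x i - t * K e g / (1 + t * K g g) * (w i * K g i * x i)
        + if i = g then t * kernelUpdate K g t e g * x g else 0 := by
    intro i
    by_cases hi : i = g
    · subst hi
      simp [kernelUpdate]
      ring
    · simp [kernelUpdate, hi]
      ring
  simp only [hsplit]
  rw [Finset.sum_add_distrib, Finset.sum_sub_distrib, ← Finset.mul_sum, hK.repr e x hx,
    hK.repr g x hx, Finset.sum_ite_eq' Finset.univ g, if_pos (Finset.mem_univ g)]
  simp only [kernelUpdate]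
  field_simp
  ring

/-- After adding 1 to the weight of `f`, the diagonal entry at `e` is `K e e - K e f ^ 2 / (1 + K f
f)`. -/
theorem sq_eq (hU : SameCoordinateBounds U U') (hw : ∀ i, 0 ≤ w i)
    (hK : IsReproducingKernel U w K) (hK' : IsReproducingKernel U' w K') (e f : E) :
    K e f ^ 2 = K' e f ^ 2 := by
  classical
  have h := diag_eq hU (weight_nonneg_update hw f zero_le_one) (hK.update hw f zero_le_one)
    (hK'.update hw f zero_le_one) e
  have hf := hK.diag_nonneg hw f
  simp only [kernelUpdate] at h
  rw [hK.symm f e, hK'.symm f e, ← diag_eq hU hw hK hK' e, ← diag_eq hU hw hK hK' f] at h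
  field_simp at h
  linarith

/-- Square the `(e, f)` entry after an update at `g`: the cross term is the triple product, and all
other terms are already known to agree. -/
theorem triple_eq (hU : SameCoordinateBounds U U') (hw : ∀ i, 0 ≤ w i)
    (hK : IsReproducingKernel U w K) (hK' : IsReproducingKernel U' w K') (e f g : E) :
    K e f * K e g * K g f = K' e f * K' e g * K' g f := by
  classical
  have h := sq_eq hU (weight_nonneg_update hw g zero_le_one) (hK.update hw g zero_le_one)
    (hK'.update hw g zero_le_one) e f
  have hg := hK.diag_nonneg hw g
  have hef := sq_eq hU hw hK hK' e f
  have heg := sq_eq hU hw hK hK' e g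
  have hgf := sq_eq hU hw hK hK' g f
  have hprod : (K e g * K g f) ^ 2 = (K' e g * K' g f) ^ 2 := by rw [mul_pow, mul_pow, heg, hgf]
  simp only [kernelUpdate] at h
  rw [← diag_eq hU hw hK hK' g, one_mul, one_mul, one_mul] at h
  have hc : (1 + K g g) ≠ 0 := by positivity
  have key : ∀ a b c : ℝ, (a - b / (1 + K g g) * c) ^ 2
      = a ^ 2 - 2 * (a * b * c) / (1 + K g g) + (b * c) ^ 2 / (1 + K g g) ^ 2 := by
    intro a b c
    field_simp
    ring
  rw [key, key, hef, hprod] at h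
  have h2 : 2 * (K e f * K e g * K g f) / (1 + K g g)
      = 2 * (K' e f * K' e g * K' g f) / (1 + K g g) := by linarith
  rw [div_left_inj' hc] at h2
  linarith

/-- Any two subspaces have reproducing kernels for a common weight
such that the support of the first one is a transitive relation. -/
theorem exists_transitive (U U' : Submodule ℝ (E → ℝ)) :
    ∃ (w : E → ℝ) (K K' : E → E → ℝ), (∀ i, 0 ≤ w i) ∧ IsReproducingKernel U w K ∧
      IsReproducingKernel U' w K' ∧ ∀ e f g, K e g ≠ 0 → K g f ≠ 0 → K e f ≠ 0 := by
  classical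
  let S : Set (Set (E × E)) := {s | ∃ (w : E → ℝ) (K K' : E → E → ℝ), (∀ i, 0 ≤ w i) ∧
    IsReproducingKernel U w K ∧ IsReproducingKernel U' w K' ∧ s = {q | K q.1 q.2 ≠ 0}}
  have hS : S.Nonempty := by
    obtain ⟨K, hK⟩ := exists_one U
    obtain ⟨K', hK'⟩ := exists_one U'
    exact ⟨_, _, K, K', fun _ => zero_le_one, hK, hK', rfl⟩
  -- Choose weights for which the support of `K` is maximal; an update at `g` would enlarge a
  -- support that is not transitive.
  obtain ⟨s, hs⟩ := S.toFinite.exists_maximal hS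
  obtain ⟨w, K, K', hw, hK, hK', rfl⟩ := hs.prop
  refine ⟨w, K, K', hw, hK, hK', fun e f g heg hgf hef => ?_⟩
  -- The values of `t` at which the update at `g` kills a nonzero entry. Each entry gives an affine
  -- equation in `t`, not satisfied at 0, so at most one root.
  let bad : Set ℝ := ⋃ q : E × E, {t | K q.1 q.2 ≠ 0 ∧
    K q.1 q.2 + t * (K q.1 q.2 * K g g - K q.1 g * K g q.2) = 0}
  have hbad : bad.Finite := by
    refine Set.finite_iUnion fun q => Set.Subsingleton.finite ?_
    rintro a ⟨h0, ha⟩ b ⟨-, hb⟩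
    have hc : K q.1 q.2 * K g g - K q.1 g * K g q.2 ≠ 0 := by
      intro hc
      rw [hc, mul_zero, add_zero] at ha
      exact h0 ha
    exact mul_right_cancel₀ hc (by linarith)
  obtain ⟨t, ht, htbad⟩ := ((Set.Ioi_infinite (0 : ℝ)).sdiff hbad).nonempty
  have ht : 0 < t := ht
  have hpos : 0 < 1 + t * K g g := by
    have := mul_nonneg ht.le (hK.diag_nonneg hw g); linarith
  have hle : {q : E × E | K q.1 q.2 ≠ 0} ⊆ {q | kernelUpdate K g t q.1 q.2 ≠ 0} := by
    intro q hq h0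
    refine htbad (Set.mem_iUnion.2 ⟨q, hq, ?_⟩)
    simp only [kernelUpdate] at h0
    field_simp at h0
    linarith
  have hback := hs.le_of_ge ⟨w + Pi.single g t, _, _, weight_nonneg_update hw g ht.le,
    hK.update hw g ht.le, hK'.update hw g ht.le, rfl⟩ hle
  refine @hback (e, f) ?_ hef
  simp only [kernelUpdate, Set.mem_ofPred_eq, hef, zero_sub, neg_ne_zero]
  exact mul_ne_zero (div_ne_zero (mul_ne_zero ht.ne' heg) hpos.ne') hgf

/-- Symmetric kernels with equal squares and equal triple products, the first one with transitive
support, are conjugate by a diagonal matrix of signs. -/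
theorem exists_signs (hU : SameCoordinateBounds U U') (hw : ∀ i, 0 ≤ w i)
    (hK : IsReproducingKernel U w K) (hK' : IsReproducingKernel U' w K')
    (htrans : ∀ e f g, K e g ≠ 0 → K g f ≠ 0 → K e f ≠ 0) :
    ∃ ε : E → ℝ, (∀ e, ε e ^ 2 = 1) ∧ ∀ e f, K' e f = ε e * ε f * K e f := by
  classical
  rcases isEmpty_or_nonempty E with hE | hE
  · exact ⟨fun _ => 1, fun _ => one_pow 2, fun e => hE.elim e⟩
  -- Indices related by the support have the same nonzero positions in their rows, so `epsilon`
  -- picks the same representative for both. The sign of `e` compares `K` and `K'` at that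
  -- representative.
  let rep : E → E := fun e => Classical.epsilon fun g => K e g ≠ 0
  let ε : E → ℝ := fun e => if K' e (rep e) = K e (rep e) then 1 else -1
  have hε : ∀ e, ε e ^ 2 = 1 := fun e => by by_cases h : K' e (rep e) = K e (rep e) <;> simp [ε, h]
  have hrep : ∀ e, K' e (rep e) = ε e * K e (rep e) := by
    intro e
    by_cases h : K' e (rep e) = K e (rep e)
    · simp [ε, h]
    · have := (sq_eq_sq_iff_eq_or_eq_neg.1 (sq_eq hU hw hK hK' e (rep e)).symm).resolve_left h
      simp [ε, this]
  refine ⟨ε, hε, fun e f => ?_⟩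
  by_cases hef : K e f = 0
  · have := sq_eq hU hw hK hK' e f
    rw [hef, zero_pow two_ne_zero] at this
    rw [hef, mul_zero, pow_eq_zero_iff two_ne_zero |>.1 this.symm]
  have hfe : K f e ≠ 0 := by rwa [hK.symm f e]
  have hrr : rep f = rep e := by
    refine congrArg Classical.epsilon (funext fun g => propext ⟨fun h => ?_, fun h => ?_⟩)
    · exact htrans e g f hef h
    · exact htrans f g e hfe h
  have her : K e (rep e) ≠ 0 := Classical.epsilon_spec (p := fun g => K e g ≠ 0) ⟨f, hef⟩
  have hfr : K f (rep e) ≠ 0 := htrans f _ e hfe her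
  have hf' : K' f (rep e) = ε f * K f (rep e) := by rw [← hrr]; exact hrep f
  -- In the triple `e`, `f`, `rep e`, the two entries at the representative are nonzero and cancel,
  -- leaving the sign of the `(e, f)` entry.
  have h := triple_eq hU hw hK hK' e f (rep e)
  rw [hK.symm (rep e) f, hK'.symm (rep e) f, hf', hrep e] at h
  have h1 : K e f = K' e f * (ε e * ε f) := by
    apply mul_right_cancel₀ (mul_ne_zero her hfr)
    linarith
  rw [h1]
  linear_combination (-(ε f ^ 2) * K' e f) * hε e - K' e f * hε f

end IsReproducingKernel

/-- Two subspaces with the same coordinate bounds differ by changing the signs of coordinates. -/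
theorem SameCoordinateBounds.exists_signs {E : Type*} [Fintype E] {U U' : Submodule ℝ (E → ℝ)}
    (hU : SameCoordinateBounds U U') :
    ∃ ε : E → ℝ, (∀ e, ε e ^ 2 = 1) ∧ ∀ x ∈ U, (fun e => ε e * x e) ∈ U' := by
  obtain ⟨w, K, K', hw, hK, hK', htrans⟩ := IsReproducingKernel.exists_transitive U U'
  obtain ⟨ε, hε, h⟩ := IsReproducingKernel.exists_signs hU hw hK hK' htrans
  refine ⟨ε, hε, fun x hx => ?_⟩
  -- The reproducing property expands `x` as `∑ w i * x i • K i`; the signs carry each row of `K` to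
  -- a multiple of a row of `K'`.
  have hsum : (fun e => ε e * x e) = ∑ i, (w i * ε i * x i) • K' i := by
    funext e
    rw [Finset.sum_apply, ← hK.repr e x hx, Finset.mul_sum]
    refine Finset.sum_congr rfl fun i _ => ?_
    rw [Pi.smul_apply, smul_eq_mul, h i e, hK.symm i e]
    linear_combination (-(w i * x i * ε e * K e i)) * hε i
  rw [hsum]
  exact U'.sum_mem fun i _ => U'.smul_mem _ (hK'.mem i)

/-! ### Measurement sets as sums of squares of coboundaries -/

namespace SimpleGraph

/-- The differences of vertex potentials along the edges, in the coordinates given by `ι` and with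
an arbitrary orientation of each edge. -/
noncomputable def coboundarySpace {V : Type*} (Γ : SimpleGraph V) {e : ℕ}
    (ι : Γ.edgeSet ≃ Fin e) : Submodule ℝ (Fin e → ℝ) :=
  LinearMap.range (LinearMap.pi fun i =>
    LinearMap.proj (R := ℝ) (φ := fun _ : V => ℝ) (Quot.out (ι.symm i : Sym2 V)).1 -
      LinearMap.proj (Quot.out (ι.symm i : Sym2 V)).2)

theorem mem_coboundarySpace {V : Type*} (Γ : SimpleGraph V) {e : ℕ} (ι : Γ.edgeSet ≃ Fin e)
    (x : Fin e → ℝ) : x ∈ Γ.coboundarySpace ι ↔ ∃ q : V → ℝ, ∀ i,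
      x i = q (Quot.out (ι.symm i : Sym2 V)).1 - q (Quot.out (ι.symm i : Sym2 V)).2 := by
  simp [coboundarySpace, LinearMap.mem_range, funext_iff, eq_comm]

theorem sqLength_eq_sum {V : Type*} {d : ℕ} (p : Configuration V d) (s : Sym2 V) :
    sqLength p s = ∑ k, (p (Quot.out s).1 k - p (Quot.out s).2 k) ^ 2 := by
  conv_lhs => rw [← Quot.out_eq s]
  change ‖p (Quot.out s).1 - p (Quot.out s).2‖ ^ 2 = _
  simp [EuclideanSpace.norm_sq_eq]

/-- Each of the `d` coordinates of a configuration is an independent vertex potential, and squaring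
removes the choice of edge orientations. -/
theorem mem_measurementSet {V : Type*} (Γ : SimpleGraph V) (d : ℕ) {e : ℕ} (ι : Γ.edgeSet ≃ Fin e)
    (l : Fin e → ℝ) : l ∈ measurementSet Γ d ι ↔
      ∃ x : Fin d → Fin e → ℝ, (∀ k, x k ∈ Γ.coboundarySpace ι) ∧ ∀ i, l i = ∑ k, x k i ^ 2 := by
  constructor
  · rintro ⟨p, rfl⟩
    refine ⟨fun k i => p (Quot.out (ι.symm i : Sym2 V)).1 k - p (Quot.out (ι.symm i : Sym2 V)).2 k,
      fun k => ?_, fun i => sqLength_eq_sum p _⟩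
    exact (mem_coboundarySpace Γ ι _).2 ⟨fun v => p v k, fun _ => rfl⟩
  · rintro ⟨x, hx, hl⟩
    choose q hq using fun k => (mem_coboundarySpace Γ ι _).1 (hx k)
    refine ⟨fun v => WithLp.toLp 2 fun k => q k v, funext fun i => ?_⟩
    rw [hl i]
    simp only [hq]
    exact sqLength_eq_sum _ _

/-- The bound is linear in the squares, so it can be summed over the `d` coordinates. Conversely, a
configuration on a line, which needs `1 ≤ d`, realizes the squares of a single `x`. -/
theorem forall_coboundarySpace_iff {V : Type*} (Γ : SimpleGraph V) {d e : ℕ} (hd : 1 ≤ d)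
    (ι : Γ.edgeSet ≃ Fin e) (w : Fin e → ℝ) (j : Fin e) (r : ℝ) :
    (∀ x ∈ Γ.coboundarySpace ι, x j ^ 2 ≤ r * ∑ i, w i * x i ^ 2) ↔
      ∀ l ∈ measurementSet Γ d ι, l j ≤ r * ∑ i, w i * l i := by
  constructor
  · intro h l hl
    obtain ⟨x, hx, hl⟩ := (mem_measurementSet Γ d ι l).1 hl
    calc l j = ∑ k, x k j ^ 2 := hl j
      _ ≤ ∑ k, r * ∑ i, w i * x k i ^ 2 := Finset.sum_le_sum fun k _ => h (x k) (hx k)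
      _ = r * ∑ i, w i * l i := by
        simp only [hl, Finset.mul_sum]
        exact Finset.sum_comm
  · intro h x hx
    refine h (fun i => x i ^ 2) ((mem_measurementSet Γ d ι _).2
      ⟨Pi.single ⟨0, hd⟩ x, fun k => ?_, fun i => ?_⟩)
    · by_cases hk : k = ⟨0, hd⟩
      · subst hk
        simpa using hx
      · simp [hk]
    · rw [Finset.sum_eq_single ⟨0, hd⟩ (fun k _ hk => by simp [hk]) (by simp)]
      simp

theorem sameCoordinateBounds_of_measurementSet_eq {V W : Type*} {Γ : SimpleGraph V}
    {Δ : SimpleGraph W} {d e : ℕ} (hd : 1 ≤ d) {ι : Γ.edgeSet ≃ Fin e} {κ : Δ.edgeSet ≃ Fin e}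
    (h : measurementSet Γ d ι = measurementSet Δ d κ) :
    SameCoordinateBounds (Γ.coboundarySpace ι) (Δ.coboundarySpace κ) := fun w j r => by
  rw [forall_coboundarySpace_iff Γ hd, forall_coboundarySpace_iff Δ hd, h]

theorem measurementSet_subset {V W : Type*} {Γ : SimpleGraph V} {Δ : SimpleGraph W} {e : ℕ} (d : ℕ)
    {ι : Γ.edgeSet ≃ Fin e} {κ : Δ.edgeSet ≃ Fin e}
    (h : SameCoordinateBounds (Γ.coboundarySpace ι) (Δ.coboundarySpace κ)) :
    measurementSet Γ d ι ⊆ measurementSet Δ d κ := by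
  obtain ⟨ε, hε, hmem⟩ := h.exists_signs
  intro l hl
  obtain ⟨x, hx, hl⟩ := (mem_measurementSet Γ d ι l).1 hl
  refine (mem_measurementSet Δ d κ l).2 ⟨_, fun k => hmem (x k) (hx k), fun i => ?_⟩
  simp only [mul_pow, hε, one_mul, hl i]

end SimpleGraph

theorem mainTheorem2 {V W : Type*} [Finite V] [Finite W]
    (Γ : SimpleGraph V) (Δ : SimpleGraph W) (d₁ d₂ : ℕ) (hd₁ : 1 ≤ d₁)
    (h : SimpleGraph.MeasurementIsomorphic d₁ Γ Δ) :
    SimpleGraph.MeasurementIsomorphic d₂ Γ Δ := by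
  obtain ⟨e, ι, κ, h⟩ := h
  have hU := SimpleGraph.sameCoordinateBounds_of_measurementSet_eq hd₁ h
  exact ⟨e, ι, κ, (SimpleGraph.measurementSet_subset d₂ hU).antisymm
    (SimpleGraph.measurementSet_subset d₂ hU.symm)⟩
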